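/- Let $n\in\mathbb N$, let $\mathbb T^n=\mathbb R^n/\mathbb Z^n$, and let $F$ be a finite subgroup of $\mathbb T^n$ of order $q$. Let $\mathcal B=C(\mathbb T^n)$ be the algebra of continuous complex-valued functions on $\mathbb T^n$, and let $\mathcal A\subseteq\mathcal B$ be the subalgebra of the functions that are invariant under translation by the elements of $F$. For $f,g\in\mathcal B$ let $\langle f,g\rangle_{\mathcal A}\in\mathcal A$ be given by $$\langle f,g\rangle_{\mathcal A}(x)=q^{-1}\sum_{w\in F}f(x-w)\,\overline{g(x-w)} .$$ Let $m_0\in\mathcal B$ be a continuous low-pass filter, that is, $m_0(0)=q$ and $\langle m_0,m_0\rangle_{\mathcal A}=q$ (the constant function). A family of continuous high-pass filters corresponding to $m_0$ is a family $m_1,\dots,m_{q-1}\in\mathcal B$ such that $\langle m_j,m_k\rangle_{\mathcal A}=q\,\delta_{jk}$ for all $0\le j,k\le q-1$. 1. If $q=2$ or $n<2q-1$, then there is a family $m_1,\dots,m_{q-1}\in\mathcal B$ of continuous high-pass filters corresponding to $m_0$. 2. In particular, if $n\le 4$, then, whatever $q$ is, there is a family of continuous high-pass filters corresponding to $m_0$.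 3. If $m_0$ is infinitely differentiable and there is a family of continuous high-pass filters corresponding to $m_0$, then there is a family of high-pass filters corresponding to $m_0$ all of whose members are infinitely differentiable. -/

import Mathlib

noncomputable section

namespace WaveletFilter

/-- The torus `ℝⁿ/ℤⁿ`. -/
abbrev Torus (n : ℕ) : Type := UnitAddTorus (Fin n)

variable {n : ℕ}

/-- The algebra of continuous complex functions on the torus that are invariant under translation
by all the elements of `F`, as a star subalgebra of the algebra of all continuous functions. -/
def invariantAlgebra (F : AddSubgroup (Torus n)) : StarSubalgebra ℂ C(Torus n, ℂ) where
  carrier := {f | ∀ w ∈ F, ∀ x, f (x - w) = f x}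
  mul_mem' := fun hf hg w hw x => by
    simp only [ContinuousMap.mul_apply, hf w hw x, hg w hw x]
  add_mem' := fun hf hg w hw x => by
    simp only [ContinuousMap.add_apply, hf w hw x, hg w hw x]
  algebraMap_mem' := fun _ _ _ _ => rfl
  star_mem' := fun hf w hw x => by
    simp only [ContinuousMap.star_apply, hf w hw x]

/-- The inner product `⟨f, g⟩(x) = q⁻¹ ∑_{w ∈ F} f(x - w) conj(g(x - w))`, where `q` is the order
of `F`, with values in the algebra of `F`-invariant continuous functions. -/
def innerA (F : AddSubgroup (Torus n)) [Fintype F] (f g : C(Torus n, ℂ)) : invariantAlgebra F :=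
  ⟨{ toFun := fun x => (Fintype.card F : ℂ)⁻¹ *
        ∑ w : F, f (x - (w : Torus n)) * (starRingEnd ℂ) (g (x - (w : Torus n)))
     continuous_toFun := by fun_prop },
   fun v hv x => by
    simp only [ContinuousMap.coe_mk]
    congr 1
    refine Fintype.sum_equiv (Equiv.addLeft (⟨v, hv⟩ : F)) _ _ fun w => ?_
    simp [sub_sub]⟩

/-- A continuous low-pass filter for `F`: `m₀(0) = q` and `⟨m₀, m₀⟩ = q`. -/
structure IsLowPass (F : AddSubgroup (Torus n)) [Fintype F] (m₀ : C(Torus n, ℂ)) : Prop where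
  apply_zero : m₀ 0 = (Fintype.card F : ℂ)
  inner_self : innerA F m₀ m₀ = (Fintype.card F : invariantAlgebra F)

/-- A family `m₁, …, m_{q-1}` of continuous high-pass filters corresponding to `m₀`:
`⟨m_j, m_k⟩ = q δ_{jk}` for all `0 ≤ j, k ≤ q - 1`. The family `m` is indexed from `0`, so `m i`
is `m_{i+1}`, and `Fin.cons m₀ m` is the whole family `m₀, m₁, …, m_{q-1}`. -/
def IsHighPassFamily (F : AddSubgroup (Torus n)) [Fintype F] (m₀ : C(Torus n, ℂ))
    (m : Fin (Fintype.card F - 1) → C(Torus n, ℂ)) : Prop :=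
  ∀ j k : Fin (Fintype.card F - 1 + 1),
    innerA F ((Fin.cons m₀ m : Fin (Fintype.card F - 1 + 1) → C(Torus n, ℂ)) j)
        ((Fin.cons m₀ m : Fin (Fintype.card F - 1 + 1) → C(Torus n, ℂ)) k) =
      if j = k then (Fintype.card F : invariantAlgebra F) else 0

/-- A function on the torus `ℝⁿ/ℤⁿ` is infinitely differentiable if its `ℤⁿ`-periodic lift to `ℝⁿ`
is (the projection `ℝⁿ → ℝⁿ/ℤⁿ` is a local diffeomorphism). -/
def IsSmooth (f : C(Torus n, ℂ)) : Prop :=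
  ContDiff ℝ (⊤ : ℕ∞) (fun t : Fin n → ℝ => f (fun i => (t i : UnitAddCircle)))

end WaveletFilter

end

noncomputable section

namespace WaveletFilter

open UnitAddTorus ComplexConjugate

variable {n : ℕ}

section

/-! ### Characters of the torus and of its finite subgroups -/

/-! Every character of `F` extends to a character of the torus, and the `q` extensions form an
orthonormal basis of `C(𝕋ⁿ)` over the invariant algebra. In these coordinates a function is an
`F`-invariant map `𝕋ⁿ → ℂ^q`, and `innerA` is the pointwise Hermitian product
(`innerA_eq_inner_coord`). After division by `√q`, high-pass filters for `m₀` amount to completing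
an invariant unit field `v` to an invariant orthonormal frame (`isHighPassFamily_of_frame`).

If `n + 1 < 2q`, approximate `v` by a smooth `w`. The real lines through its values form a smooth
image of `ℝ × ℝⁿ`, so they miss some `p ∈ ℂ^q`. A unitary taking one unit vector to a different one
can be chosen continuously in the pair, so a constant frame starting at `p/‖p‖` is carried to
`w/‖w‖`, then to `-v`, and negated (`exists_frame_of_missed_line`). For `q = 2` the complement of
`v` is spanned by an explicit vector. If `n ≤ 4`, only `q = 1`, with no filter to find, remains
besides these cases.

For smoothness, replace `m₁, …, m_{q-1}` by close trigonometric polynomials, keep `m₀`, and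
orthonormalise pointwise by Gram–Schmidt, which fixes the first vector. -/

theorem innerA_apply (F : AddSubgroup (Torus n)) [Fintype F] (f g : C(Torus n, ℂ)) (x : Torus n) :
    (innerA F f g : C(Torus n, ℂ)) x = (Fintype.card F : ℂ)⁻¹ *
      ∑ w : F, f (x - (w : Torus n)) * conj (g (x - (w : Torus n))) := rfl

theorem mFourier_apply_add (k : Fin n → ℤ) (x y : Torus n) :
    mFourier k (x + y) = mFourier k x * mFourier k y := by
  simp [mFourier, fourier_apply, AddCircle.toCircle_add, smul_add, Finset.prod_mul_distrib]

theorem mFourier_apply_zero (k : Fin n → ℤ) : mFourier k (0 : Torus n) = 1 := by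
  simp [mFourier]

theorem mFourier_mul_conj (k : Fin n → ℤ) (x : Torus n) :
    mFourier k x * conj (mFourier k x) = 1 := by
  rw [← mFourier_neg, ← mFourier_add]
  simp [mFourier_zero]

theorem mFourier_apply_neg (k : Fin n → ℤ) (x : Torus n) :
    mFourier k (-x) = conj (mFourier k x) := by
  have h := mFourier_apply_add k (-x) x
  rw [neg_add_cancel, mFourier_apply_zero] at h
  calc mFourier k (-x) = mFourier k (-x) * (mFourier k x * conj (mFourier k x)) := by
        rw [mFourier_mul_conj, mul_one]
    _ = conj (mFourier k x) := by rw [← mul_assoc, ← h, one_mul]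

theorem mFourier_apply_sub (k : Fin n → ℤ) (x y : Torus n) :
    mFourier k (x - y) = mFourier k x * conj (mFourier k y) := by
  rw [sub_eq_add_neg, mFourier_apply_add, mFourier_apply_neg]

/-- The restriction of a character of the torus to a subgroup. -/
def restrictChar (F : AddSubgroup (Torus n)) (k : Fin n → ℤ) : AddChar F ℂ where
  toFun w := mFourier k (w : Torus n)
  map_zero_eq_one' := by simp [mFourier_apply_zero]
  map_add_eq_mul' v w := by simp [mFourier_apply_add]

theorem sum_mul_conj_addChar {G : Type*} [AddCommGroup G] [Fintype G] (ψ χ : AddChar G ℂ) :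
    ∑ w, ψ w * conj (χ w) = if ψ = χ then (Fintype.card G : ℂ) else 0 := by
  classical
  have h : ∀ w, ψ w * conj (χ w) = (ψ * χ⁻¹) w := fun w => by
    rw [AddChar.mul_apply, AddChar.inv_apply, AddChar.map_neg_eq_conj]
  simp_rw [h, AddChar.sum_eq_ite]
  refine if_congr ?_ rfl rfl
  rw [← AddChar.one_eq_zero, mul_inv_eq_one]

/-- Every character of a finite subgroup of the torus extends to a character of the torus. -/
theorem restrictChar_surjective (F : AddSubgroup (Torus n)) [Fintype F] :
    Function.Surjective (restrictChar F) := by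
  intro ψ
  by_contra! hψ
  -- If `ψ` is no restriction, pairing with `ψ` over `F` kills every `mFourier k` by orthogonality,
  -- hence by density every continuous function. A Urysohn function separating `0` from the rest of
  -- `F` contradicts this.
  let L : C(Torus n, ℂ) →ₗ[ℂ] ℂ :=
    { toFun := fun f => ∑ w : F, f w * conj (ψ w)
      map_add' := fun f g => by simp [add_mul, Finset.sum_add_distrib]
      map_smul' := fun c f => by simp [Finset.mul_sum, mul_assoc] }
  have hL : Continuous L := by
    change Continuous fun f : C(Torus n, ℂ) => ∑ w : F, f w * conj (ψ w)
    fun_prop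
  have hker : (Submodule.span ℂ (Set.range (mFourier (d := Fin n)))) ≤ LinearMap.ker L := by
    rw [Submodule.span_le]
    rintro _ ⟨k, rfl⟩
    change ∑ w : F, restrictChar F k w * conj (ψ w) = 0
    rw [sum_mul_conj_addChar, if_neg (hψ k)]
  have htop : LinearMap.ker L = ⊤ := by
    have hclosed : IsClosed (LinearMap.ker L : Set C(Torus n, ℂ)) :=
      isClosed_singleton.preimage hL
    have := Submodule.topologicalClosure_minimal _ hker hclosed
    rwa [span_mFourier_closure_eq_top, top_le_iff] at this
  have hfin : (Set.range fun w : {w : F // w ≠ 0} => ((w : F) : Torus n)).Finite :=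
    Set.finite_range _
  obtain ⟨f, hf0, hf1, -⟩ := exists_continuous_zero_one_of_isClosed hfin.isClosed
    (isClosed_singleton (x := (0 : Torus n))) (by
      rw [Set.disjoint_singleton_right]
      rintro ⟨w, hw⟩
      exact w.2 (Subtype.ext hw))
  let g : C(Torus n, ℂ) := ⟨fun x => (f x : ℂ), by fun_prop⟩
  have hg : L g = 0 := by
    have : g ∈ LinearMap.ker L := htop ▸ Submodule.mem_top
    exact this
  have : L g = 1 := by
    change ∑ w : F, (f w : ℂ) * conj (ψ w) = 1
    rw [Finset.sum_eq_single 0]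
    · have : f 0 = 1 := hf1 rfl
      simp [this]
    · intro w _ hw
      have : f w = 0 := hf0 ⟨⟨w, hw⟩, rfl⟩
      simp [this]
    · simp
  exact one_ne_zero (this.symm.trans hg)

/-! ### Coordinates over the invariant algebra -/

variable {ι : Type*}

/-- The coordinates of `f` over the invariant functions, with respect to the orthonormal basis of
characters `mFourier (k i)`. -/
def coord (F : AddSubgroup (Torus n)) [Fintype F] (k : ι → Fin n → ℤ)
    (f : C(Torus n, ℂ)) (x : Torus n) : EuclideanSpace ℂ ι :=
  WithLp.toLp 2 fun i => (innerA F f (mFourier (k i)) : C(Torus n, ℂ)) x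

variable {F : AddSubgroup (Torus n)} [Fintype F] {k : ι → Fin n → ℤ} {e : ι ≃ AddChar F ℂ}

theorem coord_apply (f : C(Torus n, ℂ)) (x : Torus n) (i : ι) :
    coord F k f x i = (innerA F f (mFourier (k i)) : C(Torus n, ℂ)) x := rfl

theorem continuous_coord (f : C(Torus n, ℂ)) : Continuous (coord F k f) :=
  (PiLp.continuous_toLp 2 _).comp (continuous_pi fun _ => map_continuous _)

theorem coord_sub_mem (f : C(Torus n, ℂ)) {w : Torus n} (hw : w ∈ F) (x : Torus n) :
    coord F k f (x - w) = coord F k f x := by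
  ext i
  exact (innerA F f (mFourier (k i))).2 w hw x

theorem coord_sub (f g : C(Torus n, ℂ)) (x : Torus n) :
    coord F k (f - g) x = coord F k f x - coord F k g x := by
  ext i
  simp [coord_apply, innerA_apply, sub_mul, Finset.sum_sub_distrib, mul_sub]

variable [Fintype ι]

/-- The function whose coordinates are given by `u`. -/
def ofCoord (k : ι → Fin n → ℤ) (u : C(Torus n, EuclideanSpace ℂ ι)) : C(Torus n, ℂ) where
  toFun x := ∑ i, u x i * mFourier (k i) x
  continuous_toFun := by fun_prop

theorem ofCoord_apply (u : C(Torus n, EuclideanSpace ℂ ι)) (x : Torus n) :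
    ofCoord k u x = ∑ i, u x i * mFourier (k i) x := rfl

/-- Fourier inversion on `F`: summing over all characters leaves only the term `w = 0` of the orbit
average. -/
theorem ofCoord_coord (hk : ∀ i (w : F), mFourier (k i) (w : Torus n) = e i w)
    (f : C(Torus n, ℂ)) (u : C(Torus n, EuclideanSpace ℂ ι))
    (hu : ∀ x, u x = coord F k f x) : ofCoord k u = f := by
  classical
  ext x
  have h : ∀ (i : ι) (w : F),
      conj (mFourier (k i) (x - w)) * mFourier (k i) x = e i w := fun i w => by
    rw [mFourier_apply_sub, hk, map_mul, Complex.conj_conj, mul_right_comm,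
      mul_comm (conj _), mFourier_mul_conj, one_mul]
  simp only [ofCoord_apply, hu, coord_apply, innerA_apply, mul_assoc, Finset.sum_mul, h]
  rw [← Finset.mul_sum, Finset.sum_comm]
  have hs : ∀ w : F, ∑ i, e i w = if w = 0 then (Fintype.card F : ℂ) else 0 := fun w => by
    rw [e.sum_comp fun ψ : AddChar F ℂ => ψ w, AddChar.sum_apply_eq_ite]
  simp_rw [← Finset.mul_sum, hs]
  have hq : (Fintype.card F : ℂ) ≠ 0 := Nat.cast_ne_zero.2 Fintype.card_ne_zero
  simp only [mul_ite, mul_zero, Finset.sum_ite_eq', Finset.mem_univ, if_true,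
    ZeroMemClass.coe_zero, sub_zero]
  field_simp

/-- Invariant coefficients come out of the sum over `F`, and orthogonality of characters removes the
mixed terms. The arguments swap because `inner` is conjugate-linear in the first one. -/
theorem innerA_ofCoord (hk : ∀ i (w : F), mFourier (k i) (w : Torus n) = e i w)
    (u v : C(Torus n, EuclideanSpace ℂ ι))
    (hu : ∀ w ∈ F, ∀ x, u (x - w) = u x) (hv : ∀ w ∈ F, ∀ x, v (x - w) = v x) (x : Torus n) :
    (innerA F (ofCoord k u) (ofCoord k v) : C(Torus n, ℂ)) x = inner ℂ (v x) (u x) := by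
  classical
  have hq : (Fintype.card F : ℂ) ≠ 0 := Nat.cast_ne_zero.2 Fintype.card_ne_zero
  have h : ∀ w : F, ofCoord k u (x - w) * conj (ofCoord k v (x - w)) =
      ∑ i, ∑ j, (u x i * mFourier (k i) x * conj (v x j * mFourier (k j) x)) *
        (e j w * conj (e i w)) := fun w => by
    simp only [ofCoord_apply, hu w w.2 x, hv w w.2 x, map_sum, Finset.sum_mul_sum,
      mFourier_apply_sub, hk, map_mul, Complex.conj_conj]
    refine Finset.sum_congr rfl fun i _ => Finset.sum_congr rfl fun j _ => by ring
  rw [innerA_apply]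
  simp_rw [h]
  rw [Finset.sum_comm]
  simp_rw [Finset.sum_comm (s := (Finset.univ : Finset F)), ← Finset.mul_sum,
    sum_mul_conj_addChar, e.injective.eq_iff, mul_ite, mul_zero, Finset.sum_ite_eq' Finset.univ, Finset.mem_univ,
    if_true, ← Finset.sum_mul]
  rw [mul_comm, mul_assoc, mul_inv_cancel₀ hq, mul_one, PiLp.inner_apply]
  refine Finset.sum_congr rfl fun i _ => ?_
  rw [RCLike.inner_apply, map_mul]
  linear_combination (u x i * conj (v x i)) * mFourier_mul_conj (k i) x

theorem innerA_eq_inner_coord (hk : ∀ i (w : F), mFourier (k i) (w : Torus n) = e i w)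
    (f g : C(Torus n, ℂ)) (x : Torus n) :
    (innerA F f g : C(Torus n, ℂ)) x = inner ℂ (coord F k g x) (coord F k f x) := by
  have := innerA_ofCoord hk ⟨coord F k f, continuous_coord f⟩ ⟨coord F k g, continuous_coord g⟩
    (fun w hw x => coord_sub_mem f hw x) (fun w hw x => coord_sub_mem g hw x) x
  rwa [ofCoord_coord hk f _ fun _ => rfl, ofCoord_coord hk g _ fun _ => rfl] at this

/-- The squared norm of the coordinate vector is the mean of `|f|²` over the `F`-orbit of `x`. -/
theorem norm_coord_le (hk : ∀ i (w : F), mFourier (k i) (w : Torus n) = e i w)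
    (f : C(Torus n, ℂ)) (x : Torus n) : ‖coord F k f x‖ ≤ ‖f‖ := by
  have hq : (0 : ℝ) < Fintype.card F := Nat.cast_pos.2 Fintype.card_pos
  refine le_of_sq_le_sq ?_ (norm_nonneg f)
  have h := innerA_eq_inner_coord hk f f x
  rw [inner_self_eq_norm_sq_to_K] at h
  have h' : ‖coord F k f x‖ ^ 2 = ‖(innerA F f f : C(Torus n, ℂ)) x‖ := by
    rw [h]; simp
  rw [h', innerA_apply, norm_mul, norm_inv, Complex.norm_natCast, inv_mul_le_iff₀ hq]
  refine (norm_sum_le _ _).trans ?_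
  calc ∑ w : F, ‖f (x - w) * conj (f (x - w))‖ ≤ ∑ w : F, ‖f‖ ^ 2 := by
        refine Finset.sum_le_sum fun w _ => ?_
        rw [norm_mul, RCLike.norm_conj, sq]
        gcongr <;> exact f.norm_coe_le_norm _
    _ = _ := by simp

/-! ### Orthonormal frames -/

theorem isHighPassFamily_iff {m₀ : C(Torus n, ℂ)} {m : Fin (Fintype.card F - 1) → C(Torus n, ℂ)} :
    IsHighPassFamily F m₀ m ↔ ∀ (i j : Fin (Fintype.card F - 1 + 1)) x,
      (innerA F ((Fin.cons m₀ m : Fin (Fintype.card F - 1 + 1) → C(Torus n, ℂ)) i)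
        ((Fin.cons m₀ m : Fin (Fintype.card F - 1 + 1) → C(Torus n, ℂ)) j) : C(Torus n, ℂ)) x =
      if i = j then (Fintype.card F : ℂ) else 0 := by
  unfold IsHighPassFamily
  refine forall_congr' fun i => forall_congr' fun j => ?_
  rw [Subtype.ext_iff, ContinuousMap.ext_iff]
  refine forall_congr' fun x => ?_
  split_ifs <;> simp

/-- An orthonormal frame of coordinate vectors extending that of `m₀` gives a family of
high-pass filters. -/
theorem isHighPassFamily_of_frame (hk : ∀ i (w : F), mFourier (k i) (w : Torus n) = e i w)
    {m₀ : C(Torus n, ℂ)}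
    (u : Fin (Fintype.card F - 1 + 1) → C(Torus n, EuclideanSpace ℂ ι))
    (hu : ∀ i, ∀ w ∈ F, ∀ x, u i (x - w) = u i x)
    (ho : ∀ x, Orthonormal ℂ fun i => u i x)
    (h0 : ∀ x, ((√(Fintype.card F) : ℝ) : ℂ) • u 0 x = coord F k m₀ x) :
    IsHighPassFamily F m₀
      fun j => ofCoord k (((√(Fintype.card F) : ℝ) : ℂ) • u j.succ) := by
  classical
  have hcons : (Fin.cons m₀ fun j => ofCoord k (((√(Fintype.card F) : ℝ) : ℂ) • u j.succ) :
      Fin (Fintype.card F - 1 + 1) → C(Torus n, ℂ)) =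
      fun i => ofCoord k (((√(Fintype.card F) : ℝ) : ℂ) • u i) := by
    funext i
    refine Fin.cases ?_ (fun j => ?_) i
    · exact (ofCoord_coord hk m₀ _ h0).symm
    · rfl
  rw [isHighPassFamily_iff]
  intro i j x
  simp only [hcons]
  rw [innerA_ofCoord hk _ _ (fun w hw x => by simp [hu i w hw x])
    (fun w hw x => by simp [hu j w hw x])]
  rw [ContinuousMap.smul_apply, ContinuousMap.smul_apply, inner_smul_left, inner_smul_right,
    orthonormal_iff_ite.1 (ho x) j i, Complex.conj_ofReal, ← mul_assoc, ← Complex.ofReal_mul,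
    Real.mul_self_sqrt (Nat.cast_nonneg _)]
  simp [eq_comm]

end

/-! ### Reflections and frames -/

section Frames

variable {E : Type*} [NormedAddCommGroup E] [InnerProductSpace ℂ E]

/-- The complex reflection along `v - p` that maps the unit vector `p` to the unit vector `v`. -/
def complexReflection (p v x : E) : E := x + (inner ℂ (v - p) x / inner ℂ (v - p) p) • (v - p)

/-- The value is `⟪v, p⟫ - 1`, which vanishes only in the equality case of Cauchy–Schwarz. -/
theorem inner_sub_self_left_ne_zero {p v : E} (hp : ‖p‖ = 1) (hv : ‖v‖ = 1) (h : v ≠ p) :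
    inner ℂ (v - p) p ≠ 0 := by
  rw [inner_sub_left, sub_ne_zero, inner_self_eq_norm_sq_to_K, hp]
  simpa using fun h' => h ((inner_eq_one_iff_of_norm_eq_one hv hp).1 h')

theorem complexReflection_self {p v : E} (hp : ‖p‖ = 1) (hv : ‖v‖ = 1) (h : v ≠ p) :
    complexReflection p v p = v := by
  rw [complexReflection, div_self (inner_sub_self_left_ne_zero hp hv h), one_smul,
    add_sub_cancel]

/-- With `s = v - p`, the map fixes the complement of `s` and multiplies `s` by `-⟪p, s⟫ / ⟪s, p⟫`,
which has modulus one. -/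
theorem inner_complexReflection {p v : E} (hp : ‖p‖ = 1) (hv : ‖v‖ = 1) (h : v ≠ p) (x y : E) :
    inner ℂ (complexReflection p v x) (complexReflection p v y) = inner ℂ x y := by
  have hs := inner_sub_self_left_ne_zero hp hv h
  have hs' : inner ℂ p (v - p) ≠ 0 := by
    rwa [← inner_conj_symm, map_ne_zero]
  have key : inner ℂ (v - p) (v - p) = -inner ℂ (v - p) p - inner ℂ p (v - p) := by
    have h1 : inner ℂ p p = 1 := by rw [inner_self_eq_norm_sq_to_K, hp]; simp
    have h2 : inner ℂ v v = 1 := by rw [inner_self_eq_norm_sq_to_K, hv]; simp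
    rw [inner_sub_left v p (v - p)]
    simp only [inner_sub_left, inner_sub_right, h1, h2]
    ring
  simp only [complexReflection, inner_add_left, inner_add_right, inner_smul_left,
    inner_smul_right, key, map_div₀, inner_conj_symm]
  field_simp
  ring

/-- A continuous orthonormal frame can be rotated so that its `i`-th member becomes `v`, as long as
`v` avoids the `i`-th member. -/
theorem exists_frame_of_ne {X ι : Type*} [TopologicalSpace X] (u : ι → C(X, E))
    (hu : ∀ x, Orthonormal ℂ fun i => u i x) (i : ι) (v : C(X, E)) (hv : ∀ x, ‖v x‖ = 1)
    (hne : ∀ x, v x ≠ u i x) :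
    ∃ u' : ι → C(X, E), (∀ x, Orthonormal ℂ fun i => u' i x) ∧ u' i = v ∧
      ∀ x y, (∀ j, u j x = u j y) → v x = v y → ∀ j, u' j x = u' j y := by
  have h1 : ∀ x, ‖u i x‖ = 1 := fun x => (hu x).1 i
  refine ⟨fun j => ⟨fun x => complexReflection (u i x) (v x) (u j x), ?_⟩, fun x => ?_, ?_, ?_⟩
  · unfold complexReflection
    have hs : ∀ x, inner ℂ (v x - u i x) (u i x) ≠ 0 :=
      fun x => inner_sub_self_left_ne_zero (h1 x) (hv x) (hne x)
    fun_prop (disch := exact hs)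
  · classical
    rw [orthonormal_iff_ite]
    intro j k
    simp only [ContinuousMap.coe_mk]
    rw [inner_complexReflection (h1 x) (hv x) (hne x), orthonormal_iff_ite.1 (hu x)]
  · ext x
    exact complexReflection_self (h1 x) (hv x) (hne x)
  · intro x y huxy hvxy j
    simp [huxy, hvxy]

theorem orthonormal_neg {ι : Type*} {u : ι → E} (hu : Orthonormal ℂ u) :
    Orthonormal ℂ fun i => -u i :=
  ⟨fun i => by simpa using hu.1 i, fun i j hij => by simpa using hu.2 hij⟩

/-- If `v` is close to a map `w` whose directions avoid the line through a unit vector, then `v`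
is a member of a continuous orthonormal frame. -/
theorem exists_frame_of_missed_line {X ι : Type*} [TopologicalSpace X] [Fintype ι]
    [FiniteDimensional ℂ E] (hι : Module.finrank ℂ E = Fintype.card ι) (i : ι) (v w : C(X, E))
    (hv : ∀ x, ‖v x‖ = 1) (hvw : ∀ x, ‖v x - w x‖ < 1) {p : E} (hp : ∀ (r : ℝ) x, r • w x ≠ p) :
    ∃ u : ι → C(X, E), (∀ x, Orthonormal ℂ fun i => u i x) ∧ u i = v ∧
      ∀ x y, v x = v y → w x = w y → ∀ j, u j x = u j y := by
  classical
  rcases isEmpty_or_nonempty X with hX | ⟨⟨x₀⟩⟩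
  · exact ⟨fun _ => v, fun x => hX.elim x, rfl, fun x => hX.elim x⟩
  -- The case `r = 0` of `hp`, which needs a point of `X`.
  have hp0 : p ≠ 0 := fun h => hp 0 x₀ (by simp [h])
  have hw : ∀ x, w x ≠ 0 := fun x h => by
    have := hvw x
    rw [h, sub_zero, hv] at this
    exact lt_irrefl _ this
  let a : E := (‖p‖⁻¹ : ℝ) • p
  have ha : ‖a‖ = 1 := by
    simp [a, norm_smul, hp0]
  let w' : C(X, E) := ⟨fun x => (‖w x‖⁻¹ : ℝ) • w x, by
    have : ∀ x, ‖w x‖ ≠ 0 := fun x => norm_ne_zero_iff.2 (hw x)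
    fun_prop (disch := exact this)⟩
  have hw'1 : ∀ x, ‖w' x‖ = 1 := fun x => by
    simp [w', norm_smul, hw x]
  obtain ⟨b, hb⟩ := Orthonormal.exists_orthonormalBasis_extension_of_card_eq (𝕜 := ℂ) hι
    (v := fun _ : ι => a) (s := {i}) ⟨fun _ => ha, fun j k hjk => (hjk (Subsingleton.elim j k)).elim⟩
  obtain ⟨u₁, ho₁, hi₁, hu₁⟩ := exists_frame_of_ne (fun j => ContinuousMap.const X (b j))
    (fun _ => b.orthonormal) i w' hw'1 (fun x h => by
      have h' : (‖w x‖⁻¹ : ℝ) • w x = (‖p‖⁻¹ : ℝ) • p := by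
        rw [← show b i = (‖p‖⁻¹ : ℝ) • p from hb i rfl]; exact h
      refine hp (‖p‖ * ‖w x‖⁻¹) x ?_
      rw [mul_smul, h', smul_smul, mul_inv_cancel₀ (norm_ne_zero_iff.2 hp0), one_smul])
  -- The target is `-v`, since `v` itself may equal `w/‖w‖` somewhere. If `-v = w/‖w‖`, then `‖v -
  -- w‖ = 1 + ‖w‖`, which is too large.
  obtain ⟨u₂, ho₂, hi₂, hu₂⟩ := exists_frame_of_ne u₁ ho₁ i (-v) (fun x => by simp [hv])
    (fun x h => by
      have h' : v x = -((‖w x‖⁻¹ : ℝ) • w x) := by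
        rw [hi₁] at h
        exact neg_eq_iff_eq_neg.1 h
      have hpos : 0 < ‖w x‖ := norm_pos_iff.2 (hw x)
      have h2 : v x - w x = -((‖w x‖⁻¹ + 1 : ℝ) • w x) := by
        rw [h', add_smul, one_smul]; abel
      have h3 := hvw x
      rw [h2, norm_neg, norm_smul, Real.norm_of_nonneg (by positivity), add_mul,
        inv_mul_cancel₀ hpos.ne'] at h3
      linarith)
  refine ⟨fun j => -u₂ j, fun x => orthonormal_neg (ho₂ x), by simp [hi₂], ?_⟩
  intro x y hvxy hwxy j
  have h1 := hu₁ x y (fun _ => rfl) (by simp [w', hwxy])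
  simp [hu₂ x y h1 (by simp [hvxy]) j]

/-- A family close to an orthonormal family is linearly independent. -/
theorem linearIndependent_of_norm_sub_lt {ι : Type*} [Fintype ι] {u w : ι → E}
    (hu : Orthonormal ℂ u) (h : ∀ i, ‖u i - w i‖ < (Fintype.card ι : ℝ)⁻¹) :
    LinearIndependent ℂ w := by
  rw [Fintype.linearIndependent_iff]
  intro c hc
  by_contra! hne
  obtain ⟨i₀, hi₀⟩ := hne
  have : Nonempty ι := ⟨i₀⟩
  -- Pairing the relation with `u i` for the largest coefficient `c i` bounds `‖c i‖` by something
  -- strictly smaller.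
  obtain ⟨i, -, hi⟩ := Finset.exists_max_image Finset.univ (fun i => ‖c i‖) Finset.univ_nonempty
  have hpos : 0 < ‖c i‖ := (norm_pos_iff.2 hi₀).trans_le (hi i₀ (Finset.mem_univ _))
  have h1 : c i = inner ℂ (u i) (∑ j, c j • (u j - w j)) := by
    simp only [smul_sub, Finset.sum_sub_distrib, hc, sub_zero]
    exact (hu.inner_right_fintype c i).symm
  have h2 : ‖∑ j, c j • (u j - w j)‖ < ‖c i‖ := by
    calc ‖∑ j, c j • (u j - w j)‖ ≤ ∑ j, ‖c j • (u j - w j)‖ := norm_sum_le _ _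
      _ < ∑ j : ι, ‖c i‖ * (Fintype.card ι : ℝ)⁻¹ := by
        refine Finset.sum_lt_sum_of_nonempty Finset.univ_nonempty fun j _ => ?_
        rw [norm_smul]
        exact (mul_le_mul_of_nonneg_right (hi j (Finset.mem_univ _)) (norm_nonneg _)).trans_lt
          (mul_lt_mul_of_pos_left (h j) hpos)
      _ = ‖c i‖ := by
        have : (Fintype.card ι : ℝ) ≠ 0 := Nat.cast_ne_zero.2 Fintype.card_ne_zero
        simp only [Finset.sum_const, Finset.card_univ, nsmul_eq_mul]
        field_simp
  have h3 := norm_inner_le_norm (𝕜 := ℂ) (u i) (∑ j, c j • (u j - w j))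
  rw [← h1, hu.1 i, one_mul] at h3
  exact absurd h2 (not_lt.2 h3)

variable {G : Type*} [NormedAddCommGroup G] [NormedSpace ℝ G]
  {ι : Type*} [LinearOrder ι] [LocallyFiniteOrderBot ι] [WellFoundedLT ι]

/-- By induction each vector is built from smooth inner products; the only divisors are `⟪g_j,
g_j⟫`, nonzero by independence. -/
theorem contDiff_gramSchmidt {u : ι → G → E} {N : WithTop ℕ∞} (hu : ∀ i, ContDiff ℝ N (u i))
    (hli : ∀ t, LinearIndependent ℂ fun i => u i t) (i : ι) :
    ContDiff ℝ N fun t => InnerProductSpace.gramSchmidt ℂ (fun i => u i t) i := by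
  induction i using WellFoundedLT.induction with
  | ind i ih =>
    have h : (fun t => InnerProductSpace.gramSchmidt ℂ (fun i => u i t) i) = fun t => u i t -
        ∑ j ∈ Finset.Iio i, (inner ℂ (InnerProductSpace.gramSchmidt ℂ (fun i => u i t) j) (u i t) /
          inner ℂ (InnerProductSpace.gramSchmidt ℂ (fun i => u i t) j)
            (InnerProductSpace.gramSchmidt ℂ (fun i => u i t) j)) •
          InnerProductSpace.gramSchmidt ℂ (fun i => u i t) j := by
      funext t
      simp_rw [inner_self_eq_norm_sq_to_K]
      exact eq_sub_of_add_eq (InnerProductSpace.gramSchmidt_def'' ℂ (fun i => u i t) i).symm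
    rw [h]
    refine (hu i).sub (ContDiff.sum fun j hj => ?_)
    have hj' := ih j (Finset.mem_Iio.1 hj)
    simp_rw [div_eq_mul_inv]
    refine ContDiff.smul ((hj'.inner ℂ (hu i)).mul ((hj'.inner ℂ hj').inv fun t => ?_)) hj'
    exact inner_self_ne_zero.2 (InnerProductSpace.gramSchmidt_ne_zero j (hli t))

theorem contDiff_gramSchmidtNormed {u : ι → G → E} {N : ℕ∞} (hu : ∀ i, ContDiff ℝ N (u i))
    (hli : ∀ t, LinearIndependent ℂ fun i => u i t) (i : ι) :
    ContDiff ℝ N fun t => InnerProductSpace.gramSchmidtNormed ℂ (fun i => u i t) i := by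
  have h := contDiff_gramSchmidt hu hli i
  have hne : ∀ t, InnerProductSpace.gramSchmidt ℂ (fun i => u i t) i ≠ 0 :=
    fun t => InnerProductSpace.gramSchmidt_ne_zero i (hli t)
  have heq : (fun t => InnerProductSpace.gramSchmidtNormed ℂ (fun i => u i t) i) = fun t =>
      (‖InnerProductSpace.gramSchmidt ℂ (fun i => u i t) i‖⁻¹ : ℝ) •
        InnerProductSpace.gramSchmidt ℂ (fun i => u i t) i := by
    funext t
    rw [InnerProductSpace.gramSchmidtNormed, ← Complex.coe_smul, Complex.ofReal_inv]
    rfl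
  rw [heq]
  exact ((h.norm ℂ hne).inv fun t => norm_ne_zero_iff.2 (hne t)).smul h

end Frames

/-! ### Smooth functions on the torus -/

/-- The projection `ℝⁿ → ℝⁿ/ℤⁿ`. -/
def proj (t : Fin n → ℝ) : Torus n := fun i => (t i : UnitAddCircle)

theorem isOpenQuotientMap_proj : IsOpenQuotientMap (proj : (Fin n → ℝ) → Torus n) :=
  IsOpenQuotientMap.piMap fun _ => QuotientAddGroup.isOpenQuotientMap_mk

theorem isSmooth_iff {f : C(Torus n, ℂ)} :
    IsSmooth f ↔ ContDiff ℝ (⊤ : ℕ∞) fun t => f (proj t) := Iff.rfl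

theorem isSmooth_mFourier (k : Fin n → ℤ) : IsSmooth (mFourier k) := by
  have h : (fun t : Fin n → ℝ => mFourier k (proj t)) = fun t =>
      ∏ i, Complex.exp (2 * Real.pi * Complex.I * k i * (t i : ℝ)) := by
    funext t
    simp only [mFourier, proj, ContinuousMap.coe_mk, fourier_coe_apply, Complex.ofReal_one, div_one]
  rw [isSmooth_iff, h]
  have h2 : ∀ i, ContDiff ℝ (⊤ : ℕ∞) fun t : Fin n → ℝ => ((t i : ℝ) : ℂ) := fun i =>
    Complex.ofRealCLM.contDiff.comp (contDiff_apply ℝ ℝ i)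
  exact contDiff_prod fun i _ => (contDiff_const.mul (h2 i)).cexp

/-- Smooth functions on the torus are uniformly dense. -/
theorem exists_isSmooth_norm_sub_lt (f : C(Torus n, ℂ)) {ε : ℝ} (hε : 0 < ε) :
    ∃ g, IsSmooth g ∧ ‖f - g‖ < ε := by
  have hf : f ∈ (Submodule.span ℂ (Set.range (mFourier (d := Fin n)))).topologicalClosure := by
    rw [span_mFourier_closure_eq_top]; trivial
  -- The approximant is a trigonometric polynomial.
  obtain ⟨g, hg, hfg⟩ := Metric.mem_closure_iff.1 hf ε hε
  refine ⟨g, ?_, by rwa [← dist_eq_norm]⟩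
  clear hfg
  induction hg using Submodule.span_induction with
  | mem _ h => obtain ⟨k, rfl⟩ := h; exact isSmooth_mFourier k
  | zero => exact contDiff_const
  | add _ _ _ _ h₁ h₂ => exact ContDiff.add h₁ h₂
  | smul c _ _ h => exact ContDiff.const_smul c h

theorem IsSmooth.innerA {F : AddSubgroup (Torus n)} [Fintype F] {f g : C(Torus n, ℂ)}
    (hf : IsSmooth f) (hg : IsSmooth g) : IsSmooth (innerA F f g : C(Torus n, ℂ)) := by
  have htrans : ∀ {f : C(Torus n, ℂ)}, IsSmooth f → ∀ w : Torus n,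
      ContDiff ℝ (⊤ : ℕ∞) fun t => f (proj t - w) := fun {f} hf w => by
    obtain ⟨s, rfl⟩ := isOpenQuotientMap_proj.surjective w
    exact (isSmooth_iff.1 hf).comp (contDiff_id.sub (contDiff_const (c := s)))
  rw [isSmooth_iff]
  simp_rw [innerA_apply]
  exact contDiff_const.mul (ContDiff.sum fun w _ => (htrans hf w).mul
    (Complex.conjCLE.contDiff.comp (htrans hg w)))

variable {F : AddSubgroup (Torus n)} [Fintype F] {ι : Type*} [Fintype ι] {k : ι → Fin n → ℤ}

theorem contDiff_coord {f : C(Torus n, ℂ)} (hf : IsSmooth f) :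
    ContDiff ℝ (⊤ : ℕ∞) fun t => coord F k f (proj t) :=
  (contDiff_piLp 2).2 fun i => hf.innerA (isSmooth_mFourier (k i))

theorem isSmooth_ofCoord {u : C(Torus n, EuclideanSpace ℂ ι)}
    (hu : ContDiff ℝ (⊤ : ℕ∞) fun t => u (proj t)) : IsSmooth (ofCoord k u) := by
  rw [isSmooth_iff]
  simp_rw [ofCoord_apply]
  exact ContDiff.sum fun i _ => ((contDiff_piLp 2).1 hu i).mul (isSmooth_mFourier (k i))

/-! ### Existence of high-pass filters -/

section Existence

variable {F : AddSubgroup (Torus n)} [Fintype F] {ι : Type*} [Fintype ι]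

variable (F) in
/-- The orthonormal basis of characters, indexed by any type with as many elements as `F`. -/
theorem exists_characters (hι : Fintype.card ι = Fintype.card F) :
    ∃ (k : ι → Fin n → ℤ) (e : ι ≃ AddChar F ℂ),
      ∀ i (w : F), mFourier (k i) (w : Torus n) = e i w := by
  have e : ι ≃ AddChar F ℂ := Fintype.equivOfCardEq (by rw [hι, AddChar.card_eq])
  choose k hk using restrictChar_surjective F
  exact ⟨fun i => k (e i), e, fun i w => DFunLike.congr_fun (hk (e i)) w⟩

variable (F) in
theorem one_le_sqrt_card : 1 ≤ √(Fintype.card F : ℝ) :=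
  Real.one_le_sqrt.2 (Nat.one_le_cast.2 Fintype.card_pos)

/-- The coordinate vector of a filter, scaled to have norm one. -/
def unitCoord (F : AddSubgroup (Torus n)) [Fintype F] (k : ι → Fin n → ℤ) (f : C(Torus n, ℂ)) :
    C(Torus n, EuclideanSpace ℂ ι) :=
  ((√(Fintype.card F) : ℝ)⁻¹ : ℂ) • ⟨coord F k f, continuous_coord f⟩

variable {k : ι → Fin n → ℤ} {e : ι ≃ AddChar F ℂ}

theorem unitCoord_apply (f : C(Torus n, ℂ)) (x : Torus n) :
    unitCoord F k f x = ((√(Fintype.card F) : ℝ)⁻¹ : ℂ) • coord F k f x := rfl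

theorem sqrt_smul_unitCoord (f : C(Torus n, ℂ)) (x : Torus n) :
    ((√(Fintype.card F) : ℝ) : ℂ) • unitCoord F k f x = coord F k f x := by
  have h : ((√(Fintype.card F) : ℝ) : ℂ) ≠ 0 :=
    Complex.ofReal_ne_zero.2 (zero_lt_one.trans_le (one_le_sqrt_card F)).ne'
  rw [unitCoord_apply, smul_smul, mul_inv_cancel₀ h, one_smul]

theorem unitCoord_sub_mem (f : C(Torus n, ℂ)) {w : Torus n} (hw : w ∈ F) (x : Torus n) :
    unitCoord F k f (x - w) = unitCoord F k f x := by
  rw [unitCoord_apply, unitCoord_apply, coord_sub_mem f hw]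

theorem inner_unitCoord (hk : ∀ i (w : F), mFourier (k i) (w : Torus n) = e i w)
    (f g : C(Torus n, ℂ)) (x : Torus n) :
    inner ℂ (unitCoord F k g x) (unitCoord F k f x) =
      (Fintype.card F : ℂ)⁻¹ * (innerA F f g : C(Torus n, ℂ)) x := by
  rw [unitCoord_apply, unitCoord_apply, inner_smul_left, inner_smul_right,
    innerA_eq_inner_coord hk, map_inv₀, Complex.conj_ofReal, ← mul_assoc, ← mul_inv,
    ← Complex.ofReal_mul, Real.mul_self_sqrt (Nat.cast_nonneg _), Complex.ofReal_natCast]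

theorem norm_unitCoord (hk : ∀ i (w : F), mFourier (k i) (w : Torus n) = e i w)
    {f : C(Torus n, ℂ)} (hf : innerA F f f = (Fintype.card F : invariantAlgebra F))
    (x : Torus n) : ‖unitCoord F k f x‖ = 1 := by
  have h := inner_unitCoord hk f f x
  have hq : (Fintype.card F : ℂ) ≠ 0 := Nat.cast_ne_zero.2 Fintype.card_ne_zero
  rw [hf, inner_self_eq_norm_sq_to_K] at h
  have h2 : ((Fintype.card F : invariantAlgebra F) : C(Torus n, ℂ)) x = Fintype.card F := by simp
  rw [h2, inv_mul_cancel₀ hq] at h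
  have h3 : ‖unitCoord F k f x‖ ^ 2 = 1 := by
    refine Complex.ofReal_injective ?_
    rw [Complex.ofReal_pow, Complex.ofReal_one]
    exact h
  exact (pow_eq_one_iff_of_nonneg (norm_nonneg _) two_ne_zero).1 h3

theorem norm_unitCoord_sub_le (hk : ∀ i (w : F), mFourier (k i) (w : Torus n) = e i w)
    (f g : C(Torus n, ℂ)) (x : Torus n) :
    ‖unitCoord F k f x - unitCoord F k g x‖ ≤ ‖f - g‖ := by
  have h := one_le_sqrt_card F
  rw [unitCoord_apply, unitCoord_apply, ← smul_sub, ← coord_sub, norm_smul, norm_inv,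
    Complex.norm_real, Real.norm_of_nonneg (zero_le_one.trans h)]
  calc _ ≤ 1 * ‖coord F k (f - g) x‖ := by
        gcongr
        exact inv_le_one_of_one_le₀ h
    _ ≤ _ := by rw [one_mul]; exact norm_coord_le hk _ _

theorem contDiff_unitCoord {f : C(Torus n, ℂ)} (hf : IsSmooth f) :
    ContDiff ℝ (⊤ : ℕ∞) fun t => unitCoord F k f (proj t) :=
  contDiff_const.smul (contDiff_coord hf)

/-- The lines through the values of a smooth map on a low-dimensional torus miss a vector. -/
theorem exists_forall_smul_ne {w : C(Torus n, EuclideanSpace ℂ ι)}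
    (hw : ContDiff ℝ (⊤ : ℕ∞) fun t => w (proj t)) (hn : n + 1 < 2 * Fintype.card ι) :
    ∃ p, ∀ (r : ℝ) x, r • w x ≠ p := by
  -- A `C¹` map from real dimension `n + 1` to the larger dimension `2 * card ι` has a range with
  -- dense complement.
  have h : ContDiff ℝ 1 fun z : ℝ × (Fin n → ℝ) => z.1 • w (proj z.2) :=
    contDiff_fst.smul ((hw.of_le (by exact_mod_cast le_top)).comp contDiff_snd)
  have hd := h.dense_compl_range_of_finrank_lt_finrank (by
    rw [finrank_real_of_complex, finrank_euclideanSpace]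
    simp only [Module.finrank_prod, Module.finrank_self, Module.finrank_fin_fun]
    omega)
  obtain ⟨p, hp⟩ := hd.nonempty
  refine ⟨p, fun r x hrx => hp ?_⟩
  obtain ⟨t, rfl⟩ := isOpenQuotientMap_proj.surjective x
  exact ⟨(r, t), hrx⟩

theorem card_sub_one_add_one : Fintype.card F - 1 + 1 = Fintype.card F :=
  Nat.sub_add_cancel Fintype.card_pos

theorem exists_isHighPassFamily_of_lt {m₀ : C(Torus n, ℂ)} (hm₀ : IsLowPass F m₀)
    (hn : n + 1 < 2 * Fintype.card F) : ∃ m, IsHighPassFamily F m₀ m := by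
  obtain ⟨k, e, hk⟩ := exists_characters F (ι := Fin (Fintype.card F - 1 + 1))
    (by rw [Fintype.card_fin, card_sub_one_add_one])
  obtain ⟨g, hg, hmg⟩ := exists_isSmooth_norm_sub_lt m₀ one_pos
  obtain ⟨p, hp⟩ := exists_forall_smul_ne (contDiff_unitCoord (F := F) (k := k) hg)
    (by rwa [Fintype.card_fin, card_sub_one_add_one])
  obtain ⟨u, ho, h0, hu⟩ := exists_frame_of_missed_line (by simp)
    (0 : Fin (Fintype.card F - 1 + 1)) (unitCoord F k m₀) (unitCoord F k g)
    (norm_unitCoord hk hm₀.inner_self)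
    (fun x => (norm_unitCoord_sub_le hk m₀ g x).trans_lt hmg) hp
  -- The frame at `x` depends only on the coordinates of `m₀` and `g` at `x`, so it inherits their
  -- invariance.
  exact ⟨_, isHighPassFamily_of_frame hk u
    (fun i w hw x => hu _ _ (unitCoord_sub_mem _ hw x) (unitCoord_sub_mem _ hw x) i) ho
    fun x => by rw [h0, sqrt_smul_unitCoord]⟩

theorem exists_isHighPassFamily_of_card_eq_one {m₀ : C(Torus n, ℂ)} (hm₀ : IsLowPass F m₀)
    (hF : Fintype.card F = 1) : ∃ m, IsHighPassFamily F m₀ m := by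
  -- The index type of the family is empty, so only `⟨m₀, m₀⟩ = q` is left to check.
  refine ⟨fun _ => 0, fun i j => ?_⟩
  have h : ∀ i : Fin (Fintype.card F - 1 + 1), i = 0 := fun i => Fin.ext (by
    have := i.2
    simp only [Fin.val_zero]
    omega)
  rw [h i, h j, if_pos rfl, Fin.cons_zero, hm₀.inner_self]

theorem exists_isHighPassFamily_of_card_eq_two {m₀ : C(Torus n, ℂ)} (hm₀ : IsLowPass F m₀)
    (hF : Fintype.card F = 2) : ∃ m, IsHighPassFamily F m₀ m := by
  obtain ⟨k, e, hk⟩ := exists_characters F (ι := Fin 2) (by simp [hF])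
  let v := unitCoord F k m₀
  have hv : ∀ x, ‖v x‖ = 1 := norm_unitCoord hk hm₀.inner_self
  -- In `ℂ²` the complement of `(a, b)` is spanned by `(-b̄, ā)`, in any dimension `n`.
  let v' : C(Torus n, EuclideanSpace ℂ (Fin 2)) :=
    ⟨fun x => !₂[-starRingEnd ℂ (v x 1), starRingEnd ℂ (v x 0)], by
      refine (PiLp.continuous_toLp 2 _).comp (continuous_pi fun i => ?_)
      fin_cases i <;> simp <;> fun_prop⟩
  have hv' : ∀ x, ‖v' x‖ = 1 := fun x => by
    refine Eq.trans ?_ (hv x)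
    rw [EuclideanSpace.norm_eq, EuclideanSpace.norm_eq]
    simp [v', Fin.sum_univ_two, add_comm]
  have hvv' : ∀ x, inner ℂ (v x) (v' x) = 0 := fun x => by
    simp [v', PiLp.inner_apply, Fin.sum_univ_two]
    ring
  refine ⟨_, isHighPassFamily_of_frame hk (fun i => if i = 0 then v else v')
    (fun i w hw x => ?_) (fun x => ⟨fun i => ?_, fun i j hij => ?_⟩)
    fun x => by rw [if_pos rfl]; exact sqrt_smul_unitCoord _ _⟩
  · have : v (x - w) = v x := unitCoord_sub_mem _ hw x
    split_ifs
    · exact this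
    · simp [v', this]
  · dsimp only
    split_ifs
    exacts [hv x, hv' x]
  · dsimp only
    split_ifs with hi hj hj
    · exact (hij (hi.trans hj.symm)).elim
    · exact hvv' x
    · rw [← inner_conj_symm, hvv', map_zero]
    · refine (hij (Fin.ext ?_)).elim
      have h1 := i.2
      have h2 := j.2
      have h3 := Fin.val_ne_zero_iff.2 hi
      have h4 := Fin.val_ne_zero_iff.2 hj
      omega

/-- Continuous high-pass filters for a smooth low-pass filter can be made smooth. -/
theorem IsHighPassFamily.exists_isSmooth {m₀ : C(Torus n, ℂ)}
    {m : Fin (Fintype.card F - 1) → C(Torus n, ℂ)} (hm : IsHighPassFamily F m₀ m)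
    (hs : IsSmooth m₀) : ∃ m', IsHighPassFamily F m₀ m' ∧ ∀ j, IsSmooth (m' j) := by
  obtain ⟨k, e, hk⟩ := exists_characters F (ι := Fin (Fintype.card F - 1 + 1))
    (by rw [Fintype.card_fin, card_sub_one_add_one])
  have hq : (Fintype.card F : ℂ) ≠ 0 := Nat.cast_ne_zero.2 Fintype.card_ne_zero
  let M : Fin (Fintype.card F - 1 + 1) → C(Torus n, ℂ) := Fin.cons m₀ m
  have hM : ∀ x, Orthonormal ℂ fun i => unitCoord F k (M i) x := fun x => by
    rw [orthonormal_iff_ite]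
    intro i j
    rw [inner_unitCoord hk, isHighPassFamily_iff.1 hm j i x]
    simp [hq, eq_comm]
  have hε : (0 : ℝ) < (Fintype.card (Fin (Fintype.card F - 1 + 1)) : ℝ)⁻¹ :=
    inv_pos.2 (Nat.cast_pos.2 Fintype.card_pos)
  choose g hgs hg using fun j => exists_isSmooth_norm_sub_lt (m j) hε
  -- Only the high-pass filters are perturbed, each by less than `1/q`, so independence persists and
  -- `m₀` stays first.
  let N : Fin (Fintype.card F - 1 + 1) → C(Torus n, ℂ) := Fin.cons m₀ g
  have hNs : ∀ i, IsSmooth (N i) := Fin.cases hs hgs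
  have hMN : ∀ i, ‖M i - N i‖ < (Fintype.card (Fin (Fintype.card F - 1 + 1)) : ℝ)⁻¹ :=
    Fin.cases (by simpa [M, N] using hε) hg
  have hli : ∀ x, LinearIndependent ℂ fun i => unitCoord F k (N i) x := fun x =>
    linearIndependent_of_norm_sub_lt (hM x) fun i =>
      (norm_unitCoord_sub_le hk _ _ x).trans_lt (hMN i)
  have hsmooth : ∀ i, ContDiff ℝ (⊤ : ℕ∞) fun t => InnerProductSpace.gramSchmidtNormed ℂ
      (fun i => unitCoord F k (N i) (proj t)) i :=
    contDiff_gramSchmidtNormed (fun i => contDiff_unitCoord (hNs i)) fun t => hli (proj t)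
  let u : Fin (Fintype.card F - 1 + 1) →
      C(Torus n, EuclideanSpace ℂ (Fin (Fintype.card F - 1 + 1))) := fun i =>
    ⟨fun x => InnerProductSpace.gramSchmidtNormed ℂ (fun i => unitCoord F k (N i) x) i,
      isOpenQuotientMap_proj.isQuotientMap.continuous_iff.2 (hsmooth i).continuous⟩
  refine ⟨_, isHighPassFamily_of_frame hk u (fun i w hw x => ?_)
    (fun x => InnerProductSpace.gramSchmidtNormed_orthonormal (hli x)) fun x => ?_, fun j => ?_⟩
  · simp only [u, ContinuousMap.coe_mk, unitCoord_sub_mem _ hw]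
  · have h : u 0 x = unitCoord F k m₀ x := by
      have h1 : ‖unitCoord F k m₀ x‖ = 1 := (hM x).1 0
      -- Gram–Schmidt leaves the first vector alone, and it is already a unit vector.
      have h2 : InnerProductSpace.gramSchmidt ℂ (fun i => unitCoord F k (N i) x) 0 =
          unitCoord F k m₀ x := InnerProductSpace.gramSchmidt_bot _ _
      simp [u, InnerProductSpace.gramSchmidtNormed, h2, h1]
    rw [h, sqrt_smul_unitCoord]
  · exact isSmooth_ofCoord (contDiff_const.smul (hsmooth j.succ))

end Existence

end WaveletFilter

end

theorem theorem3p1 (n : ℕ) (F : AddSubgroup (WaveletFilter.Torus n)) [Fintype F]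
    (m₀ : C(WaveletFilter.Torus n, ℂ)) (hm₀ : WaveletFilter.IsLowPass F m₀) :
    ((Fintype.card F = 2 ∨ (n : ℤ) < 2 * (Fintype.card F : ℤ) - 1) →
      ∃ m : Fin (Fintype.card F - 1) → C(WaveletFilter.Torus n, ℂ),
        WaveletFilter.IsHighPassFamily F m₀ m) ∧
    (n ≤ 4 →
      ∃ m : Fin (Fintype.card F - 1) → C(WaveletFilter.Torus n, ℂ),
        WaveletFilter.IsHighPassFamily F m₀ m) ∧
    (WaveletFilter.IsSmooth m₀ →
      (∃ m : Fin (Fintype.card F - 1) → C(WaveletFilter.Torus n, ℂ),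
        WaveletFilter.IsHighPassFamily F m₀ m) →
      ∃ m : Fin (Fintype.card F - 1) → C(WaveletFilter.Torus n, ℂ),
        WaveletFilter.IsHighPassFamily F m₀ m ∧ ∀ j, WaveletFilter.IsSmooth (m j)) := by
  refine ⟨?_, fun hn => ?_, fun hs ⟨m, hm⟩ => hm.exists_isSmooth hs⟩
  · rintro (h | h)
    · exact WaveletFilter.exists_isHighPassFamily_of_card_eq_two hm₀ h
    · exact WaveletFilter.exists_isHighPassFamily_of_lt hm₀ (by omega)
  · have hpos : 0 < Fintype.card F := Fintype.card_pos
    by_cases h1 : Fintype.card F = 1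
    · exact WaveletFilter.exists_isHighPassFamily_of_card_eq_one hm₀ h1
    by_cases h2 : Fintype.card F = 2
    · exact WaveletFilter.exists_isHighPassFamily_of_card_eq_two hm₀ h2
    -- Here `q ≥ 3`, so `n + 1 ≤ 5 < 6 ≤ 2q`.
    · exact WaveletFilter.exists_isHighPassFamily_of_lt hm₀ (by omega)
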